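/- An effect algebra is a set $E$ with constants $0,1$ and a partially defined operation $+$ such that, for all $a,b,c\in E$: (i) $a+b$ is defined if and only if $b+a$ is defined, and then $a+b=b+a$; (ii) $a+b$ and $(a+b)+c$ are defined if and only if $b+c$ and $a+(b+c)$ are defined, and then $(a+b)+c=a+(b+c)$; (iii) there is a unique $a'\in E$ with $a+a'=1$; (iv) if $a+1$ is defined, then $a=0$. Write $a\le b$ if $a+c=b$ for some $c\in E$. The effect algebra $E$ satisfies the Riesz Decomposition Property (RDP) if, whenever $y_1+y_2$ is defined and $x\le y_1+y_2$, there are $x_1\le y_1$ and $x_2\le y_2$ in $E$ with $x=x_1+x_2$. A state on $E$ is a map $s:E\to[0,1]$ with $s(1)=1$ and $s(a+b)=s(a)+s(b)$ whenever $a+b$ is defined; the set $\mathcal S(E)\subseteq\mathbb R^E$ of all states carries the topology of pointwise convergence. A convex cone in a real vector space $W$ is a subset $C\ni 0$ of $W$ closed under linear combinations with nonnegative coefficients. It is a lattice cone if $C\cap(-C)=\{0\}$ and $C$ is a lattice in the order $x\le_C y\iff y-x\in C$. A base of $C$ is a convex set $B\subseteq C$ such that every nonzero $y\in C$ can be written uniquely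 as $y=\alpha x$ with $\alpha\ge 0$ and $x\in B$. A simplex is a convex subset of a real vector space that is affinely isomorphic (by a bijection preserving convex combinations) to a base of a lattice cone in some real vector space. A Choquet simplex is a compact simplex in a locally convex Hausdorff space. Theorem. Let $E$ be an effect algebra with $0\neq 1$ that satisfies (RDP). Then the state space $\mathcal S(E)$, as a subset of the locally convex Hausdorff space $\mathbb R^E$ with the product topology, is a Choquet simplex. -/

import Mathlib

/-- An effect algebra: a partial commutative algebra `(E; +, 0, 1)`.  The partial operation is
`oplus`, where `oplus a b = none` means that `a + b` is not defined and `oplus a b = some c` means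
that `a + b` is defined and equal to `c`.  An equation between values of type `Option E` thus says
that one side is defined if and only if the other one is, and that in such a case they are equal. -/
class EffectAlgebra (E : Type*) extends Zero E, One E where
  /-- the partial addition -/
  oplus : E → E → Option E
  /-- `a + b` is defined iff `b + a` is, and then they are equal -/
  oplus_comm : ∀ a b : E, oplus a b = oplus b a
  /-- `a + b` and `(a + b) + c` are defined iff `b + c` and `a + (b + c)` are, and then
  `(a + b) + c = a + (b + c)` -/
  oplus_assoc : ∀ a b c : E,
    (oplus a b).bind (fun d => oplus d c) = (oplus b c).bind (fun d => oplus a d)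
  /-- every `a` has a unique `a'` with `a + a' = 1` -/
  existsUnique_orthosupplement : ∀ a : E, ∃! a' : E, oplus a a' = some 1
  /-- if `a + 1` is defined then `a = 0` -/
  eq_zero_of_oplus_one : ∀ a c : E, oplus a 1 = some c → a = 0

namespace EffectAlgebra

/-- The relation `a ≤ b` of an effect algebra: `a + c = b` for some `c`. -/
def IsBelow {E : Type*} [EffectAlgebra E] (a b : E) : Prop :=
  ∃ c : E, oplus a c = some b

/-- The Riesz Decomposition Property: if `y₁ + y₂` is defined and `x ≤ y₁ + y₂`, then `x = x₁ + x₂`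
for some `x₁ ≤ y₁` and `x₂ ≤ y₂`. -/
def RieszDecompositionProperty (E : Type*) [EffectAlgebra E] : Prop :=
  ∀ x y₁ y₂ y : E, oplus y₁ y₂ = some y → IsBelow x y →
    ∃ x₁ x₂ : E, IsBelow x₁ y₁ ∧ IsBelow x₂ y₂ ∧ oplus x₁ x₂ = some x

/-- A state: a map `E → [0,1]` with `s 1 = 1` and `s (a + b) = s a + s b` whenever `a + b` is
defined. -/
structure IsState {E : Type*} [EffectAlgebra E] (s : E → ℝ) : Prop where
  mem_unitInterval : ∀ a : E, s a ∈ Set.Icc (0 : ℝ) 1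
  map_one : s 1 = 1
  map_oplus : ∀ a b c : E, oplus a b = some c → s c = s a + s b

/-- The state space, as a subset of the real vector space `E → ℝ`.  The topology of `E → ℝ` is the
product topology, so that it induces on states the topology of weak (pointwise) convergence. -/
def stateSpace (E : Type*) [EffectAlgebra E] : Set (E → ℝ) :=
  {s | IsState s}

end EffectAlgebra

/-- A lattice cone in a real linear space `W`: a strict convex cone `C` (that is, `0 ∈ C`, and
`C ∩ -C = {0}`) such that `C` is a lattice in the order `x ≤ y ↔ y - x ∈ C`. -/
structure IsLatticeCone {W : Type*} [AddCommGroup W] [Module ℝ W] (C : PointedCone ℝ W) :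
    Prop where
  strict : ∀ x : W, x ∈ C → -x ∈ C → x = 0
  exists_sup : ∀ x ∈ C, ∀ y ∈ C, ∃ z ∈ C, z - x ∈ C ∧ z - y ∈ C ∧
    ∀ w ∈ C, w - x ∈ C → w - y ∈ C → w - z ∈ C
  exists_inf : ∀ x ∈ C, ∀ y ∈ C, ∃ z ∈ C, x - z ∈ C ∧ y - z ∈ C ∧
    ∀ w ∈ C, x - w ∈ C → y - w ∈ C → z - w ∈ C

/-- A base of a convex cone `C`: a convex subset `B` of `C` such that every non-zero `y ∈ C` is
uniquely of the form `α • x` with `α ≥ 0` and `x ∈ B`. -/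
structure IsConeBase {W : Type*} [AddCommGroup W] [Module ℝ W] (C : PointedCone ℝ W) (B : Set W) :
    Prop where
  convex : Convex ℝ B
  subset : ∀ x ∈ B, x ∈ C
  existsUnique : ∀ y ∈ C, y ≠ 0 → ∃! p : ℝ × W, 0 ≤ p.1 ∧ p.2 ∈ B ∧ y = p.1 • p.2

/-- `K` and `B` are affinely isomorphic: there is a bijection from `K` onto `B` that preserves
convex combinations. -/
def AffinelyIsomorphic {V W : Type*} [AddCommGroup V] [Module ℝ V] [AddCommGroup W] [Module ℝ W]
    (K : Set V) (B : Set W) : Prop :=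
  ∃ f : V → W, Set.BijOn f K B ∧
    ∀ x ∈ K, ∀ y ∈ K, ∀ a b : ℝ, 0 ≤ a → 0 ≤ b → a + b = 1 →
      f (a • x + b • y) = a • f x + b • f y

/-- A simplex in a real linear space `V`: a convex subset affinely isomorphic to a base of a lattice
cone in some real linear space `W`.  It is no restriction to take `W` in the universe of `V`, since
the cone can be transported along the affine isomorphism to the cone over `K × {1}` in `V × ℝ`. -/
def IsSimplex.{u} {V : Type u} [AddCommGroup V] [Module ℝ V] (K : Set V) : Prop :=
  Convex ℝ K ∧
    ∃ (W : Type u) (_ : AddCommGroup W) (_ : Module ℝ W) (C : PointedCone ℝ W) (B : Set W),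
      IsLatticeCone C ∧ IsConeBase C B ∧ AffinelyIsomorphic K B

/-- A Choquet simplex: a compact simplex in a locally convex Hausdorff space. -/
def IsChoquetSimplex {V : Type*} [AddCommGroup V] [Module ℝ V] [TopologicalSpace V]
    [IsTopologicalAddGroup V] [ContinuousSMul ℝ V] [LocallyConvexSpace ℝ V] [T2Space V]
    (K : Set V) : Prop :=
  IsSimplex K ∧ IsCompact K

/-!
The cone over the state space is the cone of all nonnegative additive functions on `E`: such a
function is determined up to a factor by its value at `1`, which dominates all its other values, so
the states are the normalised elements and form a base (`EffectAlgebra.isConeBase_stateSpace`).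

The point of the theorem is that this cone is a lattice.  The supremum of `x` and `y` is
`y + (x - y)⁺`, where the positive part of an additive function `d` is the Riesz-Kantorovich formula
`d⁺ a = sup {d b | b ≤ a}`.  Additivity of `d⁺` is where the Riesz Decomposition Property enters: it
splits each `b ≤ a₁ + a₂` as `b₁ + b₂` with `bᵢ ≤ aᵢ`, which gives `d⁺ (a₁ + a₂) ≤ d⁺ a₁ + d⁺ a₂`
(`EffectAlgebra.IsAdditive.posPart`).  The infimum is `x + y` minus the supremum.

Compactness holds because the states form a closed subset of the cube `[0,1]^E`.
-/

namespace EffectAlgebra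

variable {E : Type*} [EffectAlgebra E]

/-! ### Partial addition and the order of an effect algebra -/

theorem oplus_assoc_right {a b c d e : E} (h : oplus a b = some d) (h' : oplus d c = some e) :
    ∃ f, oplus b c = some f ∧ oplus a f = some e := by
  have := oplus_assoc a b c
  rw [h, Option.bind_some, h'] at this
  exact Option.bind_eq_some_iff.1 this.symm

theorem oplus_assoc_left {a b c e f : E} (h : oplus b c = some f) (h' : oplus a f = some e) :
    ∃ d, oplus a b = some d ∧ oplus d c = some e := by
  have := oplus_assoc a b c
  rw [h, Option.bind_some, h'] at this
  exact Option.bind_eq_some_iff.1 this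

theorem oplus_zero (a : E) : oplus a 0 = some a := by
  have h1 : oplus (1 : E) 0 = some 1 := by
    obtain ⟨z, hz, -⟩ := existsUnique_orthosupplement (1 : E)
    have hz' : oplus z 1 = some 1 := by rw [oplus_comm, hz]
    rwa [eq_zero_of_oplus_one z 1 hz'] at hz
  -- It suffices to see that `a` and `a + 0` are both orthosupplements of `b`.
  obtain ⟨b, hb, -⟩ := existsUnique_orthosupplement a
  rw [oplus_comm] at hb
  obtain ⟨f, hf, hbf⟩ := oplus_assoc_right hb h1
  rw [hf, (existsUnique_orthosupplement b).unique hbf hb]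

theorem zero_oplus (a : E) : oplus 0 a = some a := by
  rw [oplus_comm, oplus_zero]

theorem IsBelow.refl (a : E) : IsBelow a a := ⟨0, oplus_zero a⟩

theorem zero_isBelow (a : E) : IsBelow 0 a := ⟨a, zero_oplus a⟩

theorem isBelow_one (a : E) : IsBelow a 1 := (existsUnique_orthosupplement a).exists

theorem IsBelow.oplus {a₁ a₂ a b₁ b₂ : E} (h₁ : IsBelow b₁ a₁) (h₂ : IsBelow b₂ a₂)
    (ha : oplus a₁ a₂ = some a) : ∃ b, EffectAlgebra.oplus b₁ b₂ = some b ∧ IsBelow b a := by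
  obtain ⟨c₁, h₁⟩ := h₁
  obtain ⟨c₂, h₂⟩ := h₂
  rw [oplus_comm] at h₁
  obtain ⟨f, hf, hfa⟩ := oplus_assoc_right h₁ ha
  obtain ⟨b, hb, hbf⟩ := oplus_assoc_left h₂ hf
  rw [oplus_comm] at hfa
  obtain ⟨g, -, hg⟩ := oplus_assoc_right hbf hfa
  exact ⟨b, hb, g, hg⟩

/-! ### Additive functions -/

/-- A real function on an effect algebra that is additive on the sums that are defined: a signed
finitely additive measure. -/
def IsAdditive (d : E → ℝ) : Prop :=
  ∀ a b c : E, oplus a b = some c → d c = d a + d b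

theorem IsAdditive.add {d e : E → ℝ} (hd : IsAdditive d) (he : IsAdditive e) :
    IsAdditive (d + e) := by
  intro a b c h
  simp only [Pi.add_apply, hd a b c h, he a b c h]
  ring

theorem IsAdditive.sub {d e : E → ℝ} (hd : IsAdditive d) (he : IsAdditive e) :
    IsAdditive (d - e) := by
  intro a b c h
  simp only [Pi.sub_apply, hd a b c h, he a b c h]
  ring

theorem IsAdditive.map_zero {d : E → ℝ} (hd : IsAdditive d) : d 0 = 0 := by
  linarith [hd 0 0 0 (oplus_zero 0)]

theorem IsAdditive.mono {d : E → ℝ} (hd : IsAdditive d) (h0 : ∀ a, 0 ≤ d a) {a b : E}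
    (h : IsBelow b a) : d b ≤ d a := by
  obtain ⟨c, hc⟩ := h
  linarith [hd b c a hc, h0 c]

/-- The positive part `a ↦ sup {d b | b ≤ a}` of a function `d`. It is meaningful when `d` is bounded
above on each interval `{b | b ≤ a}`; elsewhere the real supremum takes its default value. -/
noncomputable def posPart (d : E → ℝ) (a : E) : ℝ :=
  sSup (d '' {b | IsBelow b a})

theorem le_posPart {d : E → ℝ} (hbdd : ∀ a, BddAbove (d '' {b | IsBelow b a})) {a b : E}
    (h : IsBelow b a) : d b ≤ posPart d a :=
  le_csSup (hbdd a) (Set.mem_image_of_mem d h)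

theorem posPart_le {d : E → ℝ} {a : E} {r : ℝ} (h : ∀ b, IsBelow b a → d b ≤ r) :
    posPart d a ≤ r := by
  refine csSup_le ⟨d a, a, IsBelow.refl a, rfl⟩ ?_
  rintro _ ⟨b, hb, rfl⟩
  exact h b hb

/-- The Riesz Decomposition Property makes the positive part of an additive function additive. -/
theorem IsAdditive.posPart (hRDP : RieszDecompositionProperty E) {d : E → ℝ} (hd : IsAdditive d)
    (hbdd : ∀ a, BddAbove (d '' {b | IsBelow b a})) : IsAdditive (posPart d) := by
  intro a₁ a₂ a ha
  apply le_antisymm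
  · refine posPart_le fun b hb => ?_
    obtain ⟨b₁, b₂, h₁, h₂, h⟩ := hRDP b a₁ a₂ a ha hb
    rw [hd b₁ b₂ b h]
    exact add_le_add (le_posPart hbdd h₁) (le_posPart hbdd h₂)
  · rw [← le_sub_iff_add_le]
    refine posPart_le fun b₁ h₁ => ?_
    rw [le_sub_comm]
    refine posPart_le fun b₂ h₂ => ?_
    obtain ⟨b, hb, hba⟩ := h₁.oplus h₂ ha
    linarith [hd b₁ b₂ b hb, le_posPart hbdd hba]

/-! ### The cone of nonnegative additive functions -/

/-- The cone of nonnegative additive functions on an effect algebra, that is, of its finitely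
additive finite measures. -/
def additiveCone (E : Type*) [EffectAlgebra E] : PointedCone ℝ (E → ℝ) where
  carrier := {m | (∀ a, 0 ≤ m a) ∧ IsAdditive m}
  zero_mem' := ⟨fun _ => le_rfl, fun _ _ _ _ => by simp⟩
  add_mem' := fun hx hy => ⟨fun a => add_nonneg (hx.1 a) (hy.1 a), hx.2.add hy.2⟩
  smul_mem' := by
    rintro ⟨r, hr⟩ m hm
    refine ⟨fun a => mul_nonneg hr (hm.1 a), fun a b c h => ?_⟩
    change r * m c = r * m a + r * m b
    rw [hm.2 a b c h, mul_add]

theorem mem_additiveCone {m : E → ℝ} :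
    m ∈ additiveCone E ↔ (∀ a, 0 ≤ m a) ∧ IsAdditive m := Iff.rfl

theorem additiveCone_exists_sup (hRDP : RieszDecompositionProperty E) {x y : E → ℝ}
    (hx : x ∈ additiveCone E) (hy : y ∈ additiveCone E) :
    ∃ z ∈ additiveCone E, z - x ∈ additiveCone E ∧ z - y ∈ additiveCone E ∧
      ∀ w ∈ additiveCone E, w - x ∈ additiveCone E → w - y ∈ additiveCone E →
        w - z ∈ additiveCone E := by
  have hd : IsAdditive (x - y) := hx.2.sub hy.2
  have hbdd : ∀ a, BddAbove ((x - y) '' {b | IsBelow b a}) := by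
    intro a
    refine ⟨x a, ?_⟩
    rintro _ ⟨b, hb, rfl⟩
    have := hx.2.mono hx.1 hb
    have := hy.1 b
    simp only [Pi.sub_apply]
    linarith
  have hp : IsAdditive (posPart (x - y)) := hd.posPart hRDP hbdd
  have hp0 : ∀ a, 0 ≤ posPart (x - y) a := fun a => by
    simpa only [hd.map_zero] using le_posPart hbdd (zero_isBelow a)
  have hpC : posPart (x - y) ∈ additiveCone E := ⟨hp0, hp⟩
  refine ⟨y + posPart (x - y), add_mem hy hpC, ⟨fun a => ?_, (hy.2.add hp).sub hx.2⟩, ?_, ?_⟩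
  · have := le_posPart hbdd (IsBelow.refl a)
    simp only [Pi.sub_apply, Pi.add_apply] at this ⊢
    linarith
  · rwa [add_sub_cancel_left]
  · intro w hw hwx hwy
    refine ⟨fun a => ?_, hw.2.sub (hy.2.add hp)⟩
    -- For `b ≤ a` one has `(x - y) b ≤ (w - y) b ≤ (w - y) a`.
    have : posPart (x - y) a ≤ (w - y) a := by
      refine posPart_le fun b hb => (?_ : _ ≤ (w - y) b).trans (hwy.2.mono hwy.1 hb)
      have := hwx.1 b
      simp only [Pi.sub_apply] at this ⊢
      linarith
    simp only [Pi.sub_apply, Pi.add_apply] at this ⊢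
    linarith

theorem isLatticeCone_additiveCone (hRDP : RieszDecompositionProperty E) :
    IsLatticeCone (additiveCone E) where
  strict x hx hx' := funext fun a => le_antisymm (neg_nonneg.1 (hx'.1 a)) (hx.1 a)
  exists_sup _ hx _ hy := additiveCone_exists_sup hRDP hx hy
  exists_inf x hx y hy := by
    obtain ⟨z, -, hzx, hzy, hmin⟩ := additiveCone_exists_sup hRDP hx hy
    refine ⟨x + y - z, ?_, ?_, ?_, ?_⟩
    · exact hmin (x + y) (add_mem hx hy) (by rwa [add_sub_cancel_left])
        (by rwa [add_sub_cancel_right])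
    · rwa [show x - (x + y - z) = z - y by abel]
    · rwa [show y - (x + y - z) = z - x by abel]
    · intro w hw hwx hwy
      -- `x + y - w` is an upper bound of `x` and `y`.
      rw [show x + y - z - w = (x + y - w) - z by abel]
      refine hmin _ ?_ ?_ ?_
      · rw [add_sub_assoc]
        exact add_mem hx hwy
      · rwa [show x + y - w - x = y - w by abel]
      · rwa [show x + y - w - y = x - w by abel]

/-! ### The state space -/

theorem mem_stateSpace_iff {s : E → ℝ} : s ∈ stateSpace E ↔ s ∈ additiveCone E ∧ s 1 = 1 := by
  constructor
  · intro h
    exact ⟨⟨fun a => (h.mem_unitInterval a).1, h.map_oplus⟩, h.map_one⟩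
  · rintro ⟨h, h1⟩
    exact ⟨fun a => ⟨h.1 a, h1 ▸ h.2.mono h.1 (isBelow_one a)⟩, h1, h.2⟩

theorem convex_stateSpace : Convex ℝ (stateSpace E) := by
  intro x hx y hy a b ha hb hab
  rw [mem_stateSpace_iff] at *
  refine ⟨add_mem ((additiveCone E).smul_mem ha hx.1) ((additiveCone E).smul_mem hb hy.1), ?_⟩
  simp [hx.2, hy.2, hab]

theorem isConeBase_stateSpace : IsConeBase (additiveCone E) (stateSpace E) where
  convex := convex_stateSpace
  subset _ hx := (mem_stateSpace_iff.1 hx).1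
  existsUnique y hy hy0 := by
    have h1 : y 1 ≠ 0 := fun h => hy0 <| funext fun a =>
      le_antisymm ((hy.2.mono hy.1 (isBelow_one a)).trans h.le) (hy.1 a)
    refine ⟨(y 1, (y 1)⁻¹ • y), ⟨hy.1 1, mem_stateSpace_iff.2 ⟨?_, ?_⟩, ?_⟩, ?_⟩
    · exact (additiveCone E).smul_mem (inv_nonneg.2 (hy.1 1)) hy
    · simp [h1]
    · simp [smul_smul, h1]
    · rintro ⟨r, s⟩ ⟨-, hs, hrs⟩
      dsimp only at hs hrs
      have hr : y 1 = r := by simp [hrs, hs.map_one]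
      rw [hr] at h1 ⊢
      rw [hrs, smul_smul, inv_mul_cancel₀ h1, one_smul]

theorem isCompact_stateSpace : IsCompact (stateSpace E) := by
  have hcube : IsCompact (Set.univ.pi fun _ : E => Set.Icc (0 : ℝ) 1) :=
    isCompact_univ_pi fun _ => isCompact_Icc
  refine hcube.of_isClosed_subset ?_ fun s hs a _ => hs.mem_unitInterval a
  have h : stateSpace E = {s | ∀ a, s a ∈ Set.Icc (0 : ℝ) 1} ∩ ({s | s 1 = 1} ∩
      {s | ∀ a b c : E, oplus a b = some c → s c = s a + s b}) := by
    ext s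
    exact ⟨fun h => ⟨h.1, h.2, h.3⟩, fun h => ⟨h.1, h.2.1, h.2.2⟩⟩
  rw [h]
  refine IsClosed.inter ?_ (IsClosed.inter ?_ ?_)
  · simp only [Set.ofPred_forall]
    exact isClosed_iInter fun a => isClosed_Icc.preimage (continuous_apply a)
  · exact isClosed_eq (continuous_apply 1) continuous_const
  · simp only [Set.ofPred_forall]
    exact isClosed_iInter fun a => isClosed_iInter fun b => isClosed_iInter fun c =>
      isClosed_iInter fun _ => isClosed_eq (by fun_prop) (by fun_prop)

end EffectAlgebra

theorem mainTheorem7 (E : Type*) [EffectAlgebra E] (hE : (0 : E) ≠ 1)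
    (hRDP : EffectAlgebra.RieszDecompositionProperty E) :
    IsChoquetSimplex (EffectAlgebra.stateSpace E) :=
  ⟨⟨EffectAlgebra.convex_stateSpace, E → ℝ, inferInstance, inferInstance,
    EffectAlgebra.additiveCone E, EffectAlgebra.stateSpace E,
    EffectAlgebra.isLatticeCone_additiveCone hRDP, EffectAlgebra.isConeBase_stateSpace,
    id, Set.bijOn_id _, fun _ _ _ _ _ _ _ _ _ => rfl⟩, EffectAlgebra.isCompact_stateSpace⟩
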